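/- Let $G$ be a finite simple graph with path distance $d$ (with $d=\infty$ between different components). For integers $k,\ell\ge 0$, an eulerian $k$-trail of length $\ell$ in $G$ is a tuple $(x_0,\dots,x_k)$ of pairwise distinct vertices with $d(x_i,x_{i+1})<\infty$ for all $0\le i<k$ and $\mathrm{len}(x_0,\dots,x_k):=\sum_{i=0}^{k-1}d(x_i,x_{i+1})=\ell$. Let $EMC_{k,\ell}(G)$ be the free abelian group generated by these trails (and $EMC_{-1,\ell}(G)=0$), with differential $\partial_{k,\ell}=\sum_{i=1}^{k-1}(-1)^i\partial^i_{k,\ell}:EMC_{k,\ell}(G)\to EMC_{k-1,\ell}(G)$, where $\partial^i_{k,\ell}(x_0,\dots,x_k)=(x_0,\dots,\widehat{x_i},\dots,x_k)$ if the shortened tuple still has length $\ell$, and $\partial^i_{k,\ell}(x_0,\dots,x_k)=0$ otherwise. The eulerian magnitude homology of $G$ is $EMH_{k,\ell}(G)=\ker\partial_{k,\ell}/\mathrm{im}\,\partial_{k+1,\ell}$, and $\beta_{k,k}(G)$ denotes the rank of $EMH_{k,k}(G)$. For $p\in[0,1]$ let $G(n,p)$ be the Erdős–Rényi random graph on $n$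 vertices, which equals a given graph with $m$ edges with probability $p^m(1-p)^{\binom n2-m}$. **Theorem.** Fix an integer $k\ge 1$ and a real number $q>\frac{k+1}{2k-1}$. Then $$\mathbb{E}\big[\beta_{k,k}\big(G(n,n^{-q})\big)\big]\longrightarrow 0\qquad\text{as } n\to\infty .$$ -/

import Mathlib

noncomputable section

namespace EulerianMagnitude

/-- The length `d(x₀,x₁) + ⋯ + d(x_{k-1},x_k)` of a `(k+1)`-tuple of vertices, for the path
distance of `G` (which is infinite between different components). -/
def trailLength {V : Type*} (G : SimpleGraph V) {k : ℕ} (x : Fin (k + 1) → V) : ℕ∞ :=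
  ∑ i : Fin k, G.edist (x i.castSucc) (x i.succ)

/-- A `k`-trail: consecutive landmarks are distinct and at finite distance. -/
def IsTrail {V : Type*} (G : SimpleGraph V) {k : ℕ} (x : Fin (k + 1) → V) : Prop :=
  ∀ i : Fin k, x i.castSucc ≠ x i.succ ∧ G.edist (x i.castSucc) (x i.succ) ≠ ⊤

/-- The set `ET_{k,ℓ}(G)` of eulerian `k`-trails of length `ℓ`: no landmark is repeated. -/
def EulerianTrail {V : Type*} (G : SimpleGraph V) (k ℓ : ℕ) : Type _ :=
  {x : Fin (k + 1) → V // IsTrail G x ∧ trailLength G x = (ℓ : ℕ∞) ∧ Function.Injective x}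

/-- The chain group `EMC_{k,ℓ}(G)`, free abelian on the eulerian `k`-trails of length `ℓ`. -/
abbrev EMC {V : Type*} (G : SimpleGraph V) (k ℓ : ℕ) : Type _ :=
  EulerianTrail G k ℓ →₀ ℤ

/-- The tuple `(x₀,…,x̂ᵢ,…,x_{k+1})` with the interior landmark `i = j + 1` removed, so that
`i` runs over `1,…,k` as `j` runs over `Fin k`. -/
def removeInterior {V : Type*} {k : ℕ} (x : Fin (k + 2) → V) (j : Fin k) : Fin (k + 1) → V :=
  fun m => x (j.succ.castSucc.succAbove m)

/-- Removing a landmark from an eulerian trail without changing the length gives an eulerian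
trail. -/
theorem removeInterior_mem {V : Type*} {G : SimpleGraph V} {k ℓ : ℕ}
    (x : EulerianTrail G (k + 1) ℓ) (j : Fin k)
    (h : trailLength G (removeInterior x.1 j) = (ℓ : ℕ∞)) :
    IsTrail G (removeInterior x.1 j) ∧ trailLength G (removeInterior x.1 j) = (ℓ : ℕ∞) ∧
      Function.Injective (removeInterior x.1 j) := by
  have hinj : Function.Injective (removeInterior x.1 j) :=
    x.2.2.2.comp Fin.succAbove_right_injective
  refine ⟨fun i => ⟨fun he => ?_, fun ht => ?_⟩, h, hinj⟩
  · exact absurd (hinj he) (Fin.castSucc_lt_succ (i := i)).ne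
  · have hle := Finset.single_le_sum
      (f := fun i : Fin k => G.edist (removeInterior x.1 j i.castSucc) (removeInterior x.1 j i.succ))
      (fun _ _ => zero_le) (Finset.mem_univ i)
    change _ ≤ trailLength G (removeInterior x.1 j) at hle
    rw [h] at hle
    simp only [ht, top_le_iff] at hle
    exact ENat.natCast_ne_top ℓ hle

open Classical in
/-- The term `∂ⁱ(x₀,…,x_{k+1})`, `i = j + 1`: the tuple with `xᵢ` removed if that keeps the
length equal to `ℓ`, and `0` otherwise. -/
def face {V : Type*} {G : SimpleGraph V} {k ℓ : ℕ}
    (x : EulerianTrail G (k + 1) ℓ) (j : Fin k) : EMC G k ℓ :=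
  if h : trailLength G (removeInterior x.1 j) = (ℓ : ℕ∞) then
    Finsupp.single ⟨removeInterior x.1 j, removeInterior_mem x j h⟩ 1
  else 0

/-- The differential `∂_{k+1,ℓ} = ∑_{i=1}^{k} (-1)ⁱ ∂ⁱ : EMC_{k+1,ℓ}(G) → EMC_{k,ℓ}(G)`. -/
def differential {V : Type*} (G : SimpleGraph V) (k ℓ : ℕ) :
    EMC G (k + 1) ℓ →ₗ[ℤ] EMC G k ℓ :=
  Finsupp.linearCombination ℤ
    (fun x : EulerianTrail G (k + 1) ℓ => ∑ j : Fin k, (-1 : ℤ) ^ ((j : ℕ) + 1) • face x j)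

/-- The kernel of `∂_{k,ℓ}`; the chain group in degree `-1` is zero. -/
def cycles {V : Type*} (G : SimpleGraph V) : (k ℓ : ℕ) → Submodule ℤ (EMC G k ℓ)
  | 0, _ => ⊤
  | k + 1, ℓ => LinearMap.ker (differential G k ℓ)

/-- The image of `∂_{k+1,ℓ}`. -/
def boundaries {V : Type*} (G : SimpleGraph V) (k ℓ : ℕ) : Submodule ℤ (EMC G k ℓ) :=
  LinearMap.range (differential G k ℓ)

/-- Eulerian magnitude homology `EMH_{k,ℓ}(G) = ker ∂_{k,ℓ} / im ∂_{k+1,ℓ}`. -/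
abbrev EMH {V : Type*} (G : SimpleGraph V) (k ℓ : ℕ) : Type _ :=
  cycles G k ℓ ⧸ (boundaries G k ℓ).submoduleOf (cycles G k ℓ)

/-- The Betti number `β_{k,k}(G)`, the rank of `EMH_{k,k}(G)`. -/
def betti {V : Type*} (G : SimpleGraph V) (k : ℕ) : ℕ :=
  Module.finrank ℤ (EMH G k k)

/-- The expectation of `β_{k,k}` for the Erdős–Rényi random graph `G(n,p)` on `n` vertices, in
which each pair of distinct vertices is an edge independently with probability `p`. -/
def expectedBetti (k n : ℕ) (p : unitInterval) : ℝ :=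
  ∫ G, (betti G k : ℝ) ∂(SimpleGraph.binomialRandom (Fin n) p)

end EulerianMagnitude

end

/-!
In degree `(k, k)` a trail is a path `x₀ ~ x₁ ~ ⋯ ~ xₖ` with distinct vertices. Its `i`-th face
survives exactly when `xᵢ₋₁` and `xᵢ₊₁` are not adjacent, and the place of this nonadjacent step can
be read off from the face. Hence the support of a cycle is *move-closed*: at each interior position
a path of the support has a chord `xᵢ₋₁ ~ xᵢ₊₁`, or another vertex can replace `xᵢ` without leaving
the support (`isMoveClosed_support`). Since `β` is at most the number of paths that occur in some
cycle (`betti_le_ncard`), it is enough to show that such a path lies in a set `U` of bounded size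
that spans at least `(2k - 1) / (k + 1)` edges per vertex. For `p = n ^ (-q)` the expected number
of these sets tends to zero, as `q (2k - 1) > k + 1` (`expectedBetti_le`).

Density is measured by the deficit `D(U) = 2|U| - e(U)`, which does not increase when a vertex with
two neighbours in `U` is added. The bound to be proved is `(k + 1) D(U) ≤ 3|U|`.

The path itself has deficit at most `k + 2`. Adding vertices with two neighbours in the current set
gives either a set so large that `D ≤ k + 2` is already enough, or a set closed under this
operation. In the second case the paths inside it form a move-closed family with fixed endpoints
`a` and `b` (`IsMoveClosed.exists_dense_superset`), and `U` is taken to be the set of its vertices.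

For such a family (`IsMoveClosed.deficit_le`), let `Lⱼ` be the set of vertices visited at position
`j`. A vertex of `Lⱼ` has two neighbours in `Lⱼ₋₂ ∪ Lⱼ₋₁`, and two in `Lⱼ₊₁ ∪ Lⱼ₊₂`, so layers can be
added from left to right or from right to left without raising the deficit. Starting from `a` and
`L₁` this gives `D(U) ≤ 4 + |L₁| - deg b`, and from the other end `D(U) ≤ 4 + |Lₖ₋₁| - deg a`. As
`|L₁| ≤ deg a` and `|Lₖ₋₁| ≤ deg b`, it follows that `D(U) ≤ 3`, or `D(U) ≤ 4` and `|L₁| ≤ deg b`.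
A bound `D(U) ≤ 3` suffices because `|U| ≥ k + 1`. Two further situations lead to it: two
consecutive layers with one vertex each, since the sweeps can start from that edge, and a vertex
visited at two positions, since it gets an additional neighbour in a suitable order. In the
remaining case the layers are disjoint and no two consecutive ones are singletons, whence
`2|U| ≥ 3k + 2`, and `D(U) ≤ 4` suffices.
-/

namespace EulerianMagnitude

open Finset

/-! ### Deficit of a vertex set -/

section Deficit

open Classical in
/-- The edges of `G` with both endpoints in `S`. -/
noncomputable def edgesIn {V : Type*} (G : SimpleGraph V) (S : Finset V) : Finset (Sym2 V) :=
  {e ∈ S.sym2 | e ∈ G.edgeSet}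

open Classical in
/-- The neighbours of `w` inside `S`. -/
noncomputable def nbrsIn {V : Type*} (G : SimpleGraph V) (w : V) (S : Finset V) : Finset V :=
  {v ∈ S | G.Adj w v}

/-- The deficit `2|S| - e(S)`: it measures how far the subgraph induced on `S` is from having
twice as many edges as vertices. -/
noncomputable def deficit {V : Type*} (G : SimpleGraph V) (S : Finset V) : ℤ :=
  2 * (#S : ℤ) - #(edgesIn G S)

variable {V : Type*} {G : SimpleGraph V}

lemma mem_nbrsIn {w v : V} {S : Finset V} : v ∈ nbrsIn G w S ↔ v ∈ S ∧ G.Adj w v := by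
  simp [nbrsIn]

lemma nbrsIn_mono (w : V) {S T : Finset V} (h : S ⊆ T) : nbrsIn G w S ⊆ nbrsIn G w T :=
  fun _ hv => mem_nbrsIn.2 ⟨h (mem_nbrsIn.1 hv).1, (mem_nbrsIn.1 hv).2⟩

lemma deficit_singleton_le (a : V) : deficit G {a} ≤ 2 := by
  simp [deficit]

variable [DecidableEq V]

lemma card_edgesIn_insert {w : V} {S : Finset V} (hw : w ∉ S) :
    #(edgesIn G S) + #(nbrsIn G w S) ≤ #(edgesIn G (insert w S)) := by
  have hinj : Set.InjOn (fun v => s(w, v)) (nbrsIn G w S : Set V) := by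
    intro u _ v _ h
    exact Sym2.congr_right.1 h
  rw [← card_image_of_injOn hinj, ← card_union_of_disjoint]
  · refine card_le_card (union_subset ?_ ?_)
    · intro e he
      simp only [edgesIn, mem_filter, mem_sym2_iff, mem_insert] at he ⊢
      exact ⟨fun a ha => Or.inr (he.1 a ha), he.2⟩
    · intro e he
      obtain ⟨v, hv, rfl⟩ := mem_image.1 he
      rw [mem_nbrsIn] at hv
      simp only [edgesIn, mem_filter, mk_mem_sym2_iff, mem_insert, SimpleGraph.mem_edgeSet]
      exact ⟨⟨by simp, Or.inr hv.1⟩, hv.2⟩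
  · rw [disjoint_left]
    intro e he he'
    obtain ⟨v, hv, rfl⟩ := mem_image.1 he'
    simp only [edgesIn, mem_filter, mk_mem_sym2_iff] at he
    exact hw he.1.1

lemma deficit_insert_le {w : V} {S : Finset V} (hw : w ∉ S) :
    deficit G (insert w S) ≤ deficit G S + 2 - #(nbrsIn G w S) := by
  have h := card_edgesIn_insert (G := G) hw
  simp only [deficit, card_insert_of_notMem hw]
  push_cast
  omega

lemma deficit_union_le {S A : Finset V} (c : ℕ)
    (h : ∀ w ∈ A, w ∉ S → c ≤ #(nbrsIn G w S)) :
    deficit G (S ∪ A) ≤ deficit G S + (2 - (c : ℤ)) * #(A \ S) := by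
  induction A using Finset.induction_on with
  | empty => simp
  | insert a A ha ih =>
    have ih := ih fun w hw => h w (mem_insert_of_mem hw)
    by_cases haS : a ∈ S
    · rwa [union_insert, insert_eq_of_mem (mem_union_left _ haS), insert_sdiff_of_mem _ haS]
    · have h1 := h a (mem_insert_self _ _) haS
      have h2 := card_le_card (nbrsIn_mono (G := G) a (subset_union_left (s₁ := S) (s₂ := A)))
      have h3 : a ∉ S ∪ A := by simp [haS, ha]
      have h4 := deficit_insert_le (G := G) h3
      rw [union_insert, insert_sdiff_of_notMem _ haS, card_insert_of_notMem (by simp [ha])]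
      push_cast
      have : (c : ℤ) ≤ #(nbrsIn G a (S ∪ A)) := by exact_mod_cast h1.trans h2
      linarith

/-- Adding vertices that have two neighbours already present does not raise the deficit. -/
lemma deficit_union_le_of_two {S A : Finset V} (h : ∀ w ∈ A, w ∉ S → 2 ≤ #(nbrsIn G w S)) :
    deficit G (S ∪ A) ≤ deficit G S := by
  simpa using deficit_union_le 2 h

/-- If every vertex of the layer `L (j + 2)` has two neighbours in the two layers before it, then
the layers can be added one after the other without raising the deficit. -/
lemma deficit_sweep_le (L : ℕ → Finset V) (S : Finset V) (J : ℕ)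
    (h0 : L 0 ⊆ S) (h1 : L 1 ⊆ S)
    (h : ∀ j, j + 2 ≤ J → ∀ w ∈ L (j + 2), 2 ≤ #(nbrsIn G w (L j ∪ L (j + 1)))) :
    deficit G (S ∪ (range (J + 1)).biUnion L) ≤ deficit G S := by
  induction J with
  | zero => simp [union_eq_left.2 h0]
  | succ J ih =>
    have ih := ih fun j hj => h j (by omega)
    rw [range_add_one, biUnion_insert, union_comm (L (J + 1)), ← union_assoc]
    refine le_trans (deficit_union_le_of_two fun w hw hwS => ?_) ih
    obtain _ | J := J
    · exact absurd (mem_union_left _ (h1 hw)) hwS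
    · refine (h J le_rfl w hw).trans (card_le_card (nbrsIn_mono _ ?_))
      refine union_subset ?_ ?_ <;>
      exact (subset_biUnion_of_mem L (by simp)).trans subset_union_right

end Deficit

/-! ### Move-closed families of paths -/

section Family

/-- A family of simple paths of length `k`, written as functions `ℕ → V` of which only the values
at `0, …, k` matter. Each path of the family and each interior position `i + 1 < J` either carries
a chord between the two neighbouring positions or can be changed at that position alone without
leaving the family. -/
structure IsMoveClosed {V : Type*} (G : SimpleGraph V) (k J : ℕ) (P : Set (ℕ → V)) : Prop where
  adj : ∀ X ∈ P, ∀ i < k, G.Adj (X i) (X (i + 1))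
  inj : ∀ X ∈ P, ∀ i ≤ k, ∀ j ≤ k, X i = X j → i = j
  move : ∀ X ∈ P, ∀ i, i + 2 ≤ J → G.Adj (X i) (X (i + 2)) ∨
    ∃ y, y ≠ X (i + 1) ∧ Function.update X (i + 1) y ∈ P

open Classical in
/-- The vertices that some path of the family visits at position `j`. -/
noncomputable def layer {V : Type*} [Fintype V] (P : Set (ℕ → V)) (j : ℕ) : Finset V :=
  {v | ∃ X ∈ P, X j = v}

variable {V : Type*} {G : SimpleGraph V}

lemma two_le_card_nbrsIn {w u v : V} {S : Finset V} (hu : u ∈ S) (hv : v ∈ S) (huv : u ≠ v)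
    (hwu : G.Adj w u) (hwv : G.Adj w v) : 2 ≤ #(nbrsIn G w S) := by
  classical
  rw [← card_pair huv]
  refine card_le_card fun x hx => ?_
  rw [mem_insert, mem_singleton] at hx
  obtain rfl | rfl := hx
  exacts [mem_nbrsIn.2 ⟨hu, hwu⟩, mem_nbrsIn.2 ⟨hv, hwv⟩]

variable [Fintype V] {k J : ℕ} {P : Set (ℕ → V)}

lemma mem_layer {j : ℕ} {v : V} : v ∈ layer P j ↔ ∃ X ∈ P, X j = v := by
  simp [layer]

lemma apply_mem_layer {X : ℕ → V} (hX : X ∈ P) (j : ℕ) : X j ∈ layer P j :=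
  mem_layer.2 ⟨X, hX, rfl⟩

variable [DecidableEq V]

lemma IsMoveClosed.two_le_left (h : IsMoveClosed G k J P) (hJ : J ≤ k) (j : ℕ) (hj : j + 2 ≤ J)
    (w : V) (hw : w ∈ layer P (j + 2)) :
    2 ≤ #(nbrsIn G w (layer P j ∪ layer P (j + 1))) := by
  obtain ⟨X, hX, rfl⟩ := mem_layer.1 hw
  have h1 : G.Adj (X (j + 2)) (X (j + 1)) := (h.adj X hX (j + 1) (by omega)).symm
  have m1 : X (j + 1) ∈ layer P j ∪ layer P (j + 1) := mem_union_right _ (apply_mem_layer hX _)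
  obtain hc | ⟨y, hy, hyP⟩ := h.move X hX j hj
  · refine two_le_card_nbrsIn m1 (mem_union_left _ (apply_mem_layer hX j)) ?_ h1 hc.symm
    intro he
    have := h.inj X hX _ (by omega) _ (by omega) he
    omega
  · have h2 := (h.adj _ hyP (j + 1) (by omega)).symm
    simp only [Function.update_self, ne_eq, OfNat.ofNat_ne_one,
      not_false_eq_true, Function.update_of_ne, add_assoc, Nat.reduceAdd, Nat.add_left_cancel_iff]
      at h2
    refine two_le_card_nbrsIn m1 (mem_union_right _ ?_) hy.symm h1 h2
    exact mem_layer.2 ⟨_, hyP, by simp⟩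

lemma IsMoveClosed.two_le_right (h : IsMoveClosed G k k P) (j : ℕ) (hj : j + 2 ≤ k)
    (w : V) (hw : w ∈ layer P j) :
    2 ≤ #(nbrsIn G w (layer P (j + 2) ∪ layer P (j + 1))) := by
  obtain ⟨X, hX, rfl⟩ := mem_layer.1 hw
  have h1 : G.Adj (X j) (X (j + 1)) := h.adj X hX j (by omega)
  have m1 : X (j + 1) ∈ layer P (j + 2) ∪ layer P (j + 1) :=
    mem_union_right _ (apply_mem_layer hX _)
  obtain hc | ⟨y, hy, hyP⟩ := h.move X hX j hj
  · refine two_le_card_nbrsIn m1 (mem_union_left _ (apply_mem_layer hX _)) ?_ h1 hc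
    intro he
    have := h.inj X hX _ (by omega) _ (by omega) he
    omega
  · have h2 := h.adj _ hyP j (by omega)
    simp only [Function.update_self, ne_eq, Nat.left_eq_add, one_ne_zero,
      not_false_eq_true, Function.update_of_ne] at h2
    refine two_le_card_nbrsIn m1 (mem_union_right _ ?_) hy.symm h1 h2
    exact mem_layer.2 ⟨_, hyP, by simp⟩

end Family

/-! ### Density of move-closed families -/

section Density

variable {V : Type*} [DecidableEq V] {G : SimpleGraph V}

/-- A sweep that starts from a single vertex `a` followed by a layer of neighbours of `a`. -/
lemma deficit_biUnion_le_of_start (L : ℕ → Finset V) {k : ℕ} (hk : 2 ≤ k) {a : V}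
    (h0 : L 0 = {a}) (hadj : ∀ w ∈ L 1, G.Adj w a)
    (hL : ∀ j, j + 2 ≤ k → ∀ w ∈ L (j + 2), 2 ≤ #(nbrsIn G w (L j ∪ L (j + 1)))) :
    deficit G ((range k).biUnion L) ≤ 2 + #(L 1) := by
  have hstart : deficit G ({a} ∪ L 1) ≤ 2 + #(L 1) := by
    have h1 := deficit_union_le (G := G) (S := {a}) (A := L 1) 1 fun w hw _ => by
      rw [Nat.one_le_iff_ne_zero, card_ne_zero]
      exact ⟨a, mem_nbrsIn.2 ⟨mem_singleton_self a, hadj w hw⟩⟩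
    have h2 := deficit_singleton_le (G := G) a
    have h3 : (#(L 1 \ {a}) : ℤ) ≤ #(L 1) := by exact_mod_cast card_le_card sdiff_subset
    push_cast at h1
    linarith
  have h := deficit_sweep_le (G := G) L ({a} ∪ L 1) (k - 1) (by simp [h0]) subset_union_right
    fun j hj => hL j (by omega)
  rw [show k - 1 + 1 = k by omega, union_eq_right.2] at h
  · exact h.trans hstart
  · rw [← h0]
    exact union_subset (subset_biUnion_of_mem L (by simp; omega))
      (subset_biUnion_of_mem L (by simp; omega))

lemma deficit_biUnion_succ_le (L : ℕ → Finset V) {k : ℕ} {b : V} (hb : L k = {b})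
    (hbL : ∀ j < k, b ∉ L j) :
    deficit G ((range (k + 1)).biUnion L) ≤
      deficit G ((range k).biUnion L) + 2 - #(nbrsIn G b ((range k).biUnion L)) := by
  rw [range_add_one, biUnion_insert, hb, singleton_union]
  exact deficit_insert_le (by simpa using hbL)

lemma biUnion_range_reflect (L : ℕ → Finset V) (k : ℕ) :
    (range (k + 1)).biUnion (fun j => L (k - j)) = (range (k + 1)).biUnion L := by
  ext v
  simp only [mem_biUnion, mem_range]
  constructor
  · rintro ⟨j, hj, hv⟩
    exact ⟨k - j, by omega, hv⟩
  · rintro ⟨j, hj, hv⟩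
    exact ⟨k - j, by omega, by rwa [Nat.sub_sub_self (by omega)]⟩

variable [Fintype V] {k : ℕ} {P : Set (ℕ → V)} {a b : V}

/-- If all paths of the family share an edge at the same position, then sweeping both ways from
that edge reaches every vertex of the family. -/
lemma IsMoveClosed.deficit_le_three_of_singletons (hP : IsMoveClosed G k k P) {i : ℕ} (hi : i < k)
    {x y : V} (hx : layer P i = {x}) (hy : layer P (i + 1) = {y}) :
    deficit G ((range (k + 1)).biUnion (layer P)) ≤ 3 := by
  have hxy : G.Adj x y := by
    obtain ⟨X, hX, rfl⟩ := mem_layer.1 (hx ▸ mem_singleton_self x)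
    have := apply_mem_layer hX (i + 1)
    rw [hy, mem_singleton] at this
    exact this ▸ hP.adj X hX i hi
  have hedge : deficit G ({x, y} : Finset V) ≤ 3 := by
    have h1 := deficit_insert_le (G := G) (w := x) (S := {y}) (by simpa using hxy.ne)
    have h2 := deficit_singleton_le (G := G) y
    have h3 : 1 ≤ #(nbrsIn G x {y}) := by
      rw [Nat.one_le_iff_ne_zero, card_ne_zero]
      exact ⟨y, mem_nbrsIn.2 ⟨mem_singleton_self y, hxy⟩⟩
    have h4 : (1 : ℤ) ≤ #(nbrsIn G x {y}) := by exact_mod_cast h3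
    linarith
  have hright := deficit_sweep_le (G := G) (fun j => layer P (i + j)) {x, y} (k - i)
    (by simp [hx]) (by simp [hy])
    fun j hj w hw => hP.two_le_left le_rfl (i + j) (by omega) w hw
  set R := {x, y} ∪ (range (k - i + 1)).biUnion fun j => layer P (i + j) with hR
  have hleft := deficit_sweep_le (G := G) (fun j => layer P (i + 1 - j)) R (i + 1)
    (by rw [hR, Nat.sub_zero, hy]; exact subset_union_left.trans' (by simp))
    (by rw [hR, Nat.add_sub_cancel, hx]; exact subset_union_left.trans' (by simp))
    fun j hj w hw => by
      have := hP.two_le_right (i + 1 - (j + 2)) (by omega) w hw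
      rwa [show i + 1 - (j + 2) + 2 = i + 1 - j by omega,
        show i + 1 - (j + 2) + 1 = i + 1 - (j + 1) by omega] at this
  refine le_of_eq_of_le (congrArg _ ?_) ((hleft.trans hright).trans hedge)
  ext v
  simp only [hR, mem_biUnion, mem_range, mem_union, mem_insert, mem_singleton]
  constructor
  · rintro ⟨j, hj, hv⟩
    by_cases hji : j ≤ i
    · exact Or.inr ⟨i + 1 - j, by omega, by rwa [Nat.sub_sub_self (by omega)]⟩
    · exact Or.inl (Or.inr ⟨j - i, by omega, by rwa [Nat.add_sub_cancel' (by omega)]⟩)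
  · rintro (((rfl | rfl) | ⟨j, hj, hv⟩) | ⟨j, hj, hv⟩)
    · exact ⟨i, by omega, by simp [hx]⟩
    · exact ⟨i + 1, by omega, by simp [hy]⟩
    · exact ⟨i + j, by omega, hv⟩
    · exact ⟨i + 1 - j, by omega, hv⟩

/-- A vertex visited at two different positions `s < j`, with `s` least possible, has one more
neighbour among the vertices swept before it than is needed: besides its neighbours at positions
below `s` it sees its predecessor on a path that visits it at position `j`, and the paths with the
same end from position `j` on sweep that predecessor without using the vertex itself. -/
lemma IsMoveClosed.deficit_le_of_repeated (hP : IsMoveClosed G k k P) (hk : 2 ≤ k)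
    (ha : ∀ X ∈ P, X 0 = a) {s j : ℕ} (hs : 1 ≤ s) (hsj : s < j) (hj : j < k) {w : V}
    (hws : w ∈ layer P s) (hwj : w ∈ layer P j)
    (hmin : ∀ t < s, ∀ i ≤ k, t < i → Disjoint (layer P t) (layer P i)) :
    deficit G ((range k).biUnion (layer P)) ≤ 1 + #(layer P 1) := by
  have hdisj : ∀ t < s, ∀ i ≤ k, t ≠ i → Disjoint (layer P t) (layer P i) := by
    intro t ht i hi hti
    obtain h | h := lt_or_gt_of_ne hti
    · exact hmin t ht i hi h
    · exact (hmin i (h.trans ht) t (by omega) h).symm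
  obtain ⟨X, hX, rfl⟩ := mem_layer.1 hwj
  have h0 : layer P 0 = {a} := by
    ext v
    rw [mem_layer, mem_singleton]
    exact ⟨fun ⟨Y, hY, h⟩ => h ▸ ha Y hY, fun h => ⟨X, hX, by rw [h, ha X hX]⟩⟩
  have haw : X j ≠ a := fun h =>
    disjoint_left.1 (hdisj 0 hs j hj.le (by omega)) (by simp [h0]) (h ▸ hwj)
  have hadj1 : ∀ v ∈ layer P 1, G.Adj v a := by
    intro v hv
    obtain ⟨Y, hY, rfl⟩ := mem_layer.1 hv
    exact ha Y hY ▸ (hP.adj Y hY 0 (by omega)).symm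
  -- The paths of the family that agree with `X` from position `j` on.
  set Q : Set (ℕ → V) := {Y | Y ∈ P ∧ ∀ i, j ≤ i → Y i = X i} with hQ
  have hQP : ∀ i, layer Q i ⊆ layer P i := by
    intro i v hv
    obtain ⟨Y, hY, rfl⟩ := mem_layer.1 hv
    exact apply_mem_layer hY.1 i
  have hXQ : X ∈ Q := ⟨hX, fun _ _ => rfl⟩
  have hQcl : IsMoveClosed G k j Q := by
    refine ⟨fun Y hY => hP.adj Y hY.1, fun Y hY => hP.inj Y hY.1, fun Y hY i hi => ?_⟩
    refine (hP.move Y hY.1 i (by omega)).imp_right fun ⟨y, hy, hyP⟩ => ⟨y, hy, hyP, fun l hl => ?_⟩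
    rw [Function.update_of_ne (by omega), hY.2 l hl]
  have hwQ : ∀ i < j, X j ∉ layer Q i := by
    intro i hi hw
    obtain ⟨Y, hY, h⟩ := mem_layer.1 hw
    have := hP.inj Y hY.1 i (by omega) j hj.le (h.trans (hY.2 j le_rfl).symm)
    omega
  have hq : X (j - 1) ∈ layer Q (j - 1) := apply_mem_layer hXQ _
  have hwq : G.Adj (X j) (X (j - 1)) := by
    have := (hP.adj X hX (j - 1) (by omega)).symm
    rwa [Nat.sub_add_cancel (by omega)] at this
  -- It suffices to reach the vertex from a set that contains all free vertices.
  suffices h : ∃ S, layer P 0 ⊆ S ∧ layer P 1 ⊆ S ∧ S ⊆ (range k).biUnion (layer P) ∧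
      deficit G S ≤ 1 + #(layer P 1) by
    obtain ⟨S, hS0, hS1, hSU, hS⟩ := h
    have h := deficit_sweep_le (G := G) (layer P) S (k - 1) hS0 hS1
      fun i hi => hP.two_le_left le_rfl i (by omega)
    rw [show k - 1 + 1 = k by omega, union_eq_right.2 hSU] at h
    exact h.trans hS
  have hsub : ∀ i < k, layer P i ⊆ (range k).biUnion (layer P) := fun i hi =>
    subset_biUnion_of_mem _ (mem_range.2 hi)
  have hsubQ : (range (j - 1 + 1)).biUnion (layer Q) ⊆ (range k).biUnion (layer P) := by
    refine biUnion_subset.2 fun i hi => (hQP i).trans (hsub i ?_)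
    have := mem_range.1 hi
    omega
  have hwU : X j ∈ (range k).biUnion (layer P) := hsub j hj hwj
  obtain rfl | hs2 := hs.eq_or_lt
  · -- The vertex is itself a neighbour of `a`: leave it out of the first layer.
    set S := {a} ∪ (layer P 1).erase (X j) with hS
    have hSd : deficit G S + 1 ≤ 2 + #(layer P 1) := by
      have h1 := deficit_union_le (G := G) (S := {a}) (A := (layer P 1).erase (X j)) 1
        fun w hw _ => by
          rw [Nat.one_le_iff_ne_zero, card_ne_zero]
          exact ⟨a, mem_nbrsIn.2 ⟨mem_singleton_self a, hadj1 w (mem_of_mem_erase hw)⟩⟩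
      have h2 := deficit_singleton_le (G := G) a
      have h3 : (#((layer P 1).erase (X j) \ {a}) : ℤ) + 1 ≤ #(layer P 1) := by
        have := card_le_card (sdiff_subset (s := (layer P 1).erase (X j)) (t := {a}))
        have := card_erase_add_one hws
        omega
      push_cast at h1
      linarith
    have hQ1 : layer Q 1 ⊆ S := fun v hv => by
      refine mem_union_right _ (mem_erase.2 ⟨?_, hQP 1 hv⟩)
      rintro rfl
      exact hwQ 1 hsj hv
    have h := deficit_sweep_le (G := G) (layer Q) S (j - 1)
      (((hQP 0).trans h0.subset).trans subset_union_left) hQ1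
      fun i hi => hQcl.two_le_left hj.le i (by omega)
    set S' := S ∪ (range (j - 1 + 1)).biUnion (layer Q) with hS'
    have hqS' : X (j - 1) ∈ S' :=
      mem_union_right _ (mem_biUnion.2 ⟨j - 1, by simp, hq⟩)
    have haS' : a ∈ S' := by simp [hS', hS]
    have hw2 : 2 ≤ #(nbrsIn G (X j) S') := by
      refine two_le_card_nbrsIn hqS' haS' ?_ hwq (hadj1 _ hws)
      intro he
      have := hP.inj X hX (j - 1) (by omega) 0 (by omega) (he.trans (ha X hX).symm)
      omega
    have hwS' : X j ∉ S' := by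
      simp only [hS', hS, mem_union, mem_singleton, mem_erase, mem_biUnion, mem_range, not_or,
        not_exists, not_and]
      exact ⟨⟨haw, fun h => absurd rfl h⟩, fun i hi => hwQ i (by omega)⟩
    have h2 := deficit_insert_le (G := G) hwS'
    have hw2' : (2 : ℤ) ≤ #(nbrsIn G (X j) S') := by exact_mod_cast hw2
    refine ⟨insert (X j) S', ?_, ?_, ?_, by linarith⟩
    · rw [h0, singleton_subset_iff]
      exact mem_insert_of_mem haS'
    · intro v hv
      by_cases hvw : v = X j
      · exact hvw ▸ mem_insert_self _ _
      · exact mem_insert_of_mem (mem_union_left _ (mem_union_right _ (mem_erase.2 ⟨hvw, hv⟩)))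
    · refine insert_subset hwU (union_subset (union_subset ?_ ?_) hsubQ)
      · exact h0 ▸ hsub 0 (by omega)
      · exact (erase_subset _ _).trans (hsub 1 (by omega))
  · have hS := deficit_biUnion_le_of_start (G := G) (layer P) hs2 h0 hadj1
      fun i hi => hP.two_le_left le_rfl i (by omega)
    -- Its neighbours at positions below `s` are not visited at position `j - 1`, so the predecessor
    -- `X (j - 1)` is a third neighbour.
    set S := (range s).biUnion (layer P) with hSdef
    have hPS : ∀ i < s, layer P i ⊆ S := fun i hi => subset_biUnion_of_mem _ (mem_range.2 hi)
    have h := deficit_sweep_le (G := G) (layer Q) S (j - 1)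
      ((hQP 0).trans (hPS 0 (by omega))) ((hQP 1).trans (hPS 1 hs2))
      fun i hi => hQcl.two_le_left hj.le i (by omega)
    set S' := S ∪ (range (j - 1 + 1)).biUnion (layer Q) with hS'
    have hqS' : X (j - 1) ∈ S' :=
      mem_union_right _ (mem_biUnion.2 ⟨j - 1, by simp, hq⟩)
    have hw3 : 3 ≤ #(nbrsIn G (X j) S') := by
      obtain ⟨r, rfl⟩ : ∃ r, s = r + 2 := ⟨s - 2, by omega⟩
      have h2 := hP.two_le_left le_rfl r (by omega) (X j) hws
      have hqn : X (j - 1) ∉ nbrsIn G (X j) (layer P r ∪ layer P (r + 1)) := by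
        intro hm
        have hqP := hQP _ hq
        obtain hm | hm := mem_union.1 (mem_nbrsIn.1 hm).1
        · exact disjoint_left.1 (hdisj r (by omega) (j - 1) (by omega) (by omega)) hm hqP
        · exact disjoint_left.1 (hdisj (r + 1) (by omega) (j - 1) (by omega) (by omega)) hm hqP
      calc 3 ≤ #(insert (X (j - 1)) (nbrsIn G (X j) (layer P r ∪ layer P (r + 1)))) := by
            rw [card_insert_of_notMem hqn]
            omega
        _ ≤ #(nbrsIn G (X j) S') := by
            refine card_le_card (insert_subset (mem_nbrsIn.2 ⟨hqS', hwq⟩) (nbrsIn_mono _ ?_))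
            exact (union_subset (hPS r (by omega)) (hPS (r + 1) (by omega))).trans
              subset_union_left
    have hwS' : X j ∉ S' := by
      simp only [hS', hSdef, mem_union, mem_biUnion, mem_range, not_or, not_exists, not_and]
      exact ⟨fun i hi hw => disjoint_left.1 (hdisj i hi s (by omega) (by omega)) hw hws,
        fun i hi => hwQ i (by omega)⟩
    have h2 := deficit_insert_le (G := G) hwS'
    have hw3' : (3 : ℤ) ≤ #(nbrsIn G (X j) S') := by exact_mod_cast hw3
    refine ⟨insert (X j) S', ?_, ?_, ?_, by linarith⟩
    · exact ((hPS 0 (by omega)).trans subset_union_left).trans (subset_insert _ _)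
    · exact ((hPS 1 hs2).trans subset_union_left).trans (subset_insert _ _)
    · exact insert_subset hwU (union_subset
        (biUnion_subset.2 fun i hi => hsub i ((mem_range.1 hi).trans (by omega))) hsubQ)

/-- If all paths have the same endpoints, then the vertices of the family span many edges. -/
theorem IsMoveClosed.deficit_le (hP : IsMoveClosed G k k P) (hk : 1 ≤ k) (hne : P.Nonempty)
    (ha : ∀ X ∈ P, X 0 = a) (hb : ∀ X ∈ P, X k = b) :
    (k + 1) * deficit G ((range (k + 1)).biUnion (layer P)) ≤
      3 * #((range (k + 1)).biUnion (layer P)) := by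
  obtain ⟨T, hT⟩ := hne
  set U := (range (k + 1)).biUnion (layer P) with hU
  have h0 : layer P 0 = {a} := by
    ext v
    rw [mem_layer, mem_singleton]
    exact ⟨fun ⟨Y, hY, h⟩ => h ▸ ha Y hY, fun h => ⟨T, hT, by rw [h, ha T hT]⟩⟩
  have hkb : layer P k = {b} := by
    ext v
    rw [mem_layer, mem_singleton]
    exact ⟨fun ⟨Y, hY, h⟩ => h ▸ hb Y hY, fun h => ⟨T, hT, by rw [h, hb T hT]⟩⟩
  have hbL : ∀ j < k, b ∉ layer P j := by
    intro j hj hm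
    obtain ⟨Y, hY, h⟩ := mem_layer.1 hm
    have := hP.inj Y hY j hj.le k le_rfl (h.trans (hb Y hY).symm)
    omega
  have haL : ∀ j ≤ k, 0 < j → a ∉ layer P j := by
    intro j hj hj0 hm
    obtain ⟨Y, hY, h⟩ := mem_layer.1 hm
    have := hP.inj Y hY j hj 0 (by omega) (h.trans (ha Y hY).symm)
    omega
  have hcard : k + 1 ≤ #U := by
    rw [← card_range (k + 1)]
    refine card_le_card_of_injOn T (fun i hi => ?_) fun i hi j hj h => ?_
    · exact mem_biUnion.2 ⟨i, hi, apply_mem_layer hT i⟩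
    · simp only [coe_range, Set.mem_Iio] at hi hj
      exact hP.inj T hT i (by omega) j (by omega) h
  have of_three : deficit G U ≤ 3 → (k + 1) * deficit G U ≤ 3 * #U := by
    intro h
    have : ((k : ℤ) + 1) ≤ #U := by exact_mod_cast hcard
    nlinarith
  by_cases hsing : ∃ i < k, #(layer P i) = 1 ∧ #(layer P (i + 1)) = 1
  · obtain ⟨i, hi, h1, h2⟩ := hsing
    obtain ⟨x, hx⟩ := card_eq_one.1 h1
    obtain ⟨y, hy⟩ := card_eq_one.1 h2
    exact of_three (hP.deficit_le_three_of_singletons hi hx hy)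
  have hpos : ∀ i, 1 ≤ #(layer P i) := fun i => card_pos.2 ⟨_, apply_mem_layer hT i⟩
  have hpair : ∀ i < k, 3 ≤ #(layer P i) + #(layer P (i + 1)) := by
    intro i hi
    by_contra hlt
    exact hsing ⟨i, hi, by have := hpos i; have := hpos (i + 1); omega,
      by have := hpos i; have := hpos (i + 1); omega⟩
  have hk2 : 2 ≤ k := by
    by_contra hlt
    obtain rfl : k = 1 := by omega
    exact hsing ⟨0, by omega, by simp [h0], by simp [hkb]⟩
  have hadj1 : ∀ v ∈ layer P 1, G.Adj v a := by
    intro v hv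
    obtain ⟨Y, hY, rfl⟩ := mem_layer.1 hv
    exact ha Y hY ▸ (hP.adj Y hY 0 (by omega)).symm
  have hadjk : ∀ v ∈ layer P (k - 1), G.Adj v b := by
    intro v hv
    obtain ⟨Y, hY, rfl⟩ := mem_layer.1 hv
    have := hP.adj Y hY (k - 1) (by omega)
    rwa [Nat.sub_add_cancel (by omega), hb Y hY] at this
  set W := (range k).biUnion (layer P) with hW
  have hleft := deficit_biUnion_le_of_start (G := G) (layer P) hk2 h0 hadj1
    (hP.two_le_left le_rfl)
  have hUW := deficit_biUnion_succ_le (G := G) (layer P) hkb hbL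
  rw [← hU, ← hW] at hUW
  rw [← hW] at hleft
  have hdegb : #(layer P (k - 1)) ≤ #(nbrsIn G b W) := card_le_card fun v hv =>
    mem_nbrsIn.2 ⟨mem_biUnion.2 ⟨k - 1, mem_range.2 (by omega), hv⟩, (hadjk v hv).symm⟩
  -- The two sweeps compare the first layer with the degree of `b`, and the last one with that
  -- of `a`.
  obtain hlt | hge := lt_or_ge (#(nbrsIn G b W)) (#(layer P 1))
  · have hright := deficit_biUnion_le_of_start (G := G) (fun j => layer P (k - j)) hk2
      (a := b) (by simpa using hkb) hadjk fun j hj w hw => by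
        have := hP.two_le_right (k - (j + 2)) (by omega) w hw
        rwa [show k - (j + 2) + 2 = k - j by omega,
          show k - (j + 2) + 1 = k - (j + 1) by omega] at this
    have hUW' := deficit_biUnion_succ_le (G := G) (fun j => layer P (k - j)) (k := k) (b := a)
      (by simpa using h0) fun j hj => haL (k - j) (by omega) (by omega)
    rw [biUnion_range_reflect, ← hU] at hUW'
    have hdega : #(layer P 1) ≤
        #(nbrsIn G a ((range k).biUnion fun j => layer P (k - j))) := card_le_card fun v hv =>
      mem_nbrsIn.2 ⟨mem_biUnion.2 ⟨k - 1, mem_range.2 (by omega),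
        by rwa [Nat.sub_sub_self (by omega)]⟩, (hadj1 v hv).symm⟩
    exact of_three (by omega)
  by_cases hrep : ∃ s, ∃ j ≤ k, s < j ∧ ¬ Disjoint (layer P s) (layer P j)
  · classical
    obtain ⟨j, hj, hsj, hdis⟩ := Nat.find_spec hrep
    obtain ⟨w, hws, hwj⟩ := not_disjoint_iff.1 hdis
    have hj' : j < k := by
      refine hj.lt_of_ne fun h => ?_
      subst h
      rw [hkb, mem_singleton] at hwj
      exact hbL _ hsj (hwj ▸ hws)
    have hs1 : 1 ≤ Nat.find hrep := by
      refine Nat.one_le_iff_ne_zero.2 fun h => ?_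
      rw [h, h0, mem_singleton] at hws
      exact haL j hj (by omega) (hws ▸ hwj)
    have h := hP.deficit_le_of_repeated hk2 ha hs1 hsj hj' hws hwj fun t ht i hi hti => by
      by_contra hd
      exact Nat.find_min hrep ht ⟨i, hi, hti, hd⟩
    rw [← hW] at h
    exact of_three (by omega)
  · have hUcard : #U = ∑ j ∈ range (k + 1), #(layer P j) := by
      refine card_biUnion fun i hi j hj hij => ?_
      by_contra hd
      have hi := mem_range.1 (mem_coe.1 hi)
      have hj := mem_range.1 (mem_coe.1 hj)
      obtain h | h := lt_or_gt_of_ne hij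
      · exact hrep ⟨i, j, by omega, h, hd⟩
      · exact hrep ⟨j, i, by omega, h, fun hd' => hd hd'.symm⟩
    have hsum : 3 * k ≤ ∑ j ∈ range k, (#(layer P j) + #(layer P (j + 1))) := by
      simpa [mul_comm] using card_nsmul_le_sum (range k)
        (fun j => #(layer P j) + #(layer P (j + 1))) 3 fun i hi => hpair i (mem_range.1 hi)
    have e1 := sum_range_succ (fun j => #(layer P j)) k
    have e2 := sum_range_succ' (fun j => #(layer P j)) k
    rw [sum_add_distrib] at hsum
    rw [hkb, card_singleton] at e1
    rw [h0, card_singleton] at e2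
    -- For `k ≥ 2` this gives `3 * #U ≥ 4 * (k + 1)`, so a deficit of `4` is small enough.
    have h2U : 3 * k + 2 ≤ 2 * #U := by omega
    have h4 : deficit G U ≤ 4 := by omega
    have h5 : 4 * ((k : ℤ) + 1) ≤ 3 * #U := by omega
    nlinarith

end Density

/-! ### Growing a dense set from a path -/

section Growth

variable {V : Type*} [DecidableEq V] {G : SimpleGraph V}

lemma deficit_image_range_le (T : ℕ → V) (k : ℕ) (hadj : ∀ i < k, G.Adj (T i) (T (i + 1)))
    (hinj : ∀ i ≤ k, ∀ j ≤ k, T i = T j → i = j) :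
    deficit G ((range (k + 1)).image T) ≤ k + 2 := by
  induction k with
  | zero => simpa using deficit_singleton_le (G := G) (T 0)
  | succ k ih =>
    have ih := ih (fun i hi => hadj i (by omega))
      fun i hi j hj => hinj i (by omega) j (by omega)
    have hnot : T (k + 1) ∉ (range (k + 1)).image T := by
      intro h
      obtain ⟨i, hi, he⟩ := mem_image.1 h
      have h1 := mem_range.1 hi
      have := hinj i (by omega) (k + 1) le_rfl he
      omega
    have h1 : 1 ≤ #(nbrsIn G (T (k + 1)) ((range (k + 1)).image T)) := by
      rw [Nat.one_le_iff_ne_zero, card_ne_zero]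
      exact ⟨T k, mem_nbrsIn.2
        ⟨mem_image_of_mem T (self_mem_range_succ k), (hadj k (by omega)).symm⟩⟩
    have h2 := deficit_insert_le (G := G) hnot
    rw [range_add_one (n := k + 1), image_insert]
    push_cast
    omega

/-- The path `T` lies in a set of bounded size with many edges. Starting from `T`, whose deficit is
at most `k + 2`, vertices with two neighbours in the current set are added. Either the set grows so
large that the bound holds for it, or it becomes closed under this operation; in the second case
the paths of the family inside it with the endpoints of `T` form a move-closed family. -/
theorem IsMoveClosed.exists_dense_superset [Fintype V] {k : ℕ} (hk : 1 ≤ k) {P : Set (ℕ → V)}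
    (hP : IsMoveClosed G k k P) {T : ℕ → V} (hT : T ∈ P) :
    ∃ U : Finset V, (∀ i ≤ k, T i ∈ U) ∧ #U ≤ (k + 1) * (k + 2) ∧
      (k + 1) * deficit G U ≤ 3 * #U := by
  classical
  set S₀ := (range (k + 1)).image T with hS₀
  have hS₀card : #S₀ = k + 1 := by
    rw [hS₀, card_image_of_injOn, card_range]
    intro i hi j hj h
    have hi := mem_range.1 (mem_coe.1 hi)
    have hj := mem_range.1 (mem_coe.1 hj)
    exact hP.inj T hT i (by omega) j (by omega) h
  have hS₀d : deficit G S₀ ≤ k + 2 := deficit_image_range_le T k (hP.adj T hT) (hP.inj T hT)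
  obtain ⟨S, hS, hmax⟩ := exists_max_image
    ({S | S₀ ⊆ S ∧ #S ≤ (k + 1) * (k + 2) ∧ deficit G S ≤ k + 2} : Finset (Finset V)) card
    ⟨S₀, by simp only [mem_filter, mem_univ, true_and, Subset.refl]
            exact ⟨by rw [hS₀card]; nlinarith, hS₀d⟩⟩
  simp only [mem_filter, mem_univ, true_and] at hS hmax
  obtain ⟨hS₀S, hScard, hSd⟩ := hS
  have hTS : ∀ i ≤ k, T i ∈ S := fun i hi =>
    hS₀S (mem_image_of_mem T (mem_range.2 (by omega)))
  obtain hfull | hlt := hScard.eq_or_lt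
  -- The size `(k + 1) * (k + 2)` is chosen so that a deficit of `k + 2` is small enough here.
  · refine ⟨S, hTS, hScard, ?_⟩
    have : (#S : ℤ) = (k + 1) * (k + 2) := by exact_mod_cast hfull
    nlinarith
  have hclosed : ∀ y, 2 ≤ #(nbrsIn G y S) → y ∈ S := by
    intro y hy
    by_contra hyS
    have h1 := deficit_insert_le (G := G) hyS
    have h2 := card_insert_of_notMem hyS
    have := hmax (insert y S) ⟨hS₀S.trans (subset_insert _ _), by omega, by omega⟩
    omega
  set Q : Set (ℕ → V) := {X | X ∈ P ∧ X 0 = T 0 ∧ X k = T k ∧ ∀ i ≤ k, X i ∈ S} with hQ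
  have hQcl : IsMoveClosed G k k Q := by
    refine ⟨fun X hX => hP.adj X hX.1, fun X hX => hP.inj X hX.1, fun X hX i hi => ?_⟩
    refine (hP.move X hX.1 i hi).imp_right fun ⟨y, hy, hyP⟩ => ⟨y, hy, hyP, ?_, ?_, ?_⟩
    · rw [Function.update_of_ne (by omega), hX.2.1]
    · rw [Function.update_of_ne (by omega), hX.2.2.1]
    · intro l hl
      by_cases hli : l = i + 1
      · rw [hli, Function.update_self]
        have h1 := hP.adj _ hyP i (by omega)
        have h2 := hP.adj _ hyP (i + 1) (by omega)
        rw [Function.update_self, Function.update_of_ne (by omega)] at h1 h2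
        refine hclosed y (two_le_card_nbrsIn (hX.2.2.2 i (by omega)) (hX.2.2.2 (i + 2) hi)
          ?_ h1.symm h2)
        intro he
        have := hP.inj X hX.1 i (by omega) (i + 2) hi he
        omega
      · rw [Function.update_of_ne hli]
        exact hX.2.2.2 l hl
  have hTQ : T ∈ Q := ⟨hT, rfl, rfl, hTS⟩
  refine ⟨(range (k + 1)).biUnion (layer Q), fun i hi => ?_, ?_, ?_⟩
  · exact mem_biUnion.2 ⟨i, mem_range.2 (by omega), apply_mem_layer hTQ i⟩
  · refine (card_le_card (biUnion_subset.2 fun i hi v hv => ?_)).trans hScard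
    obtain ⟨X, hX, rfl⟩ := mem_layer.1 hv
    exact hX.2.2.2 i (by have := mem_range.1 hi; omega)
  · exact hQcl.deficit_le hk ⟨T, hTQ⟩ (fun X hX => hX.2.1) fun X hX => hX.2.2.1

end Growth

/-! ### Supports of cycles -/

section Cycles

variable {V : Type*} {G : SimpleGraph V}

/-- A tuple of vertices, extended to all natural numbers by its last entry. -/
def toPath {k : ℕ} (x : Fin (k + 1) → V) (i : ℕ) : V :=
  x ⟨min i k, by omega⟩

lemma toPath_apply {k : ℕ} (x : Fin (k + 1) → V) (i : Fin (k + 1)) : toPath x i = x i := by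
  simp [toPath, Nat.min_eq_left (Nat.lt_succ_iff.1 i.2)]

lemma toPath_injective {k : ℕ} :
    Function.Injective (toPath : (Fin (k + 1) → V) → ℕ → V) := fun x y h => by
  ext i
  rw [← toPath_apply x, ← toPath_apply y, h]

lemma trailLength_eq_sum_range {k : ℕ} (x : Fin (k + 1) → V) :
    trailLength G x = ∑ i : Fin k, G.edist (toPath x i) (toPath x (i + 1)) := by
  refine sum_congr rfl fun i _ => ?_
  rw [← toPath_apply x i.castSucc, ← toPath_apply x i.succ, Fin.val_castSucc, Fin.val_succ]

/-- Trails whose length equals their number of steps are paths of the graph. -/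
lemma EulerianTrail.adj {k : ℕ} (x : EulerianTrail G k k) (i : ℕ) (hi : i < k) :
    G.Adj (toPath x.1 i) (toPath x.1 (i + 1)) := by
  obtain ⟨x, htr, hlen, hinj⟩ := x
  choose d hd using fun i : Fin k => ENat.ne_top_iff_exists.1 (htr i).2
  have h1 : ∀ i : Fin k, 1 ≤ d i := by
    intro i
    rw [Nat.one_le_iff_ne_zero]
    intro h0
    have := hd i
    rw [h0] at this
    exact (htr i).1 (SimpleGraph.edist_eq_zero_iff.1 this.symm)
  have hsum : ∑ i : Fin k, 1 = ∑ i : Fin k, d i := by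
    simp only [trailLength, ← hd] at hlen
    rw [sum_const, card_univ, Fintype.card_fin, smul_eq_mul, mul_one]
    exact_mod_cast hlen.symm
  have h2 := (sum_eq_sum_iff_of_le fun i _ => h1 i).1 hsum ⟨i, hi⟩ (mem_univ _)
  have h3 := hd ⟨i, hi⟩
  rw [← h2] at h3
  have h4 := SimpleGraph.edist_eq_one_iff_adj.1 h3.symm
  rwa [← toPath_apply x, ← toPath_apply x] at h4

lemma EulerianTrail.eq_of_toPath_eq {k l : ℕ} (x : EulerianTrail G k l) {i j : ℕ} (hi : i ≤ k)
    (hj : j ≤ k) (h : toPath x.1 i = toPath x.1 j) : i = j := by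
  have := Fin.mk.inj_iff.1 (x.2.2.2 h)
  omega

lemma removeInterior_eq_toPath {k : ℕ} (x : Fin (k + 2) → V) (j : Fin k) (t : Fin (k + 1)) :
    removeInterior x j t = toPath x (if (t : ℕ) ≤ j then t else t + 1) := by
  rw [removeInterior, ← toPath_apply x]
  congr 1
  simp only [Fin.succAbove, Fin.lt_def, Fin.val_castSucc, Fin.val_succ, Nat.lt_succ_iff]
  split_ifs <;> simp

lemma toPath_removeInterior {k : ℕ} (x : Fin (k + 2) → V) (j : Fin k) (t : ℕ) (ht : t ≤ k) :
    toPath (removeInterior x j) t = toPath x (if t ≤ j then t else t + 1) := by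
  have h := removeInterior_eq_toPath x j ⟨t, by omega⟩
  rwa [← toPath_apply (removeInterior x j)] at h

lemma adj_removeInterior {k : ℕ} (x : EulerianTrail G (k + 1) (k + 1)) {j i : Fin k}
    (hij : i ≠ j) : G.Adj (toPath (removeInterior x.1 j) i)
      (toPath (removeInterior x.1 j) (i + 1)) := by
  have hij' : (i : ℕ) ≠ j := fun h => hij (Fin.ext h)
  rw [toPath_removeInterior _ _ _ (by omega), toPath_removeInterior _ _ _ (by omega)]
  by_cases h : (i : ℕ) ≤ j
  · rw [if_pos h, if_pos (by omega)]
    exact x.adj i (by omega)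
  · rw [if_neg h, if_neg (by omega)]
    exact x.adj (i + 1) (by omega)

lemma toPath_removeInterior_self {k : ℕ} (x : Fin (k + 2) → V) (j : Fin k) :
    toPath (removeInterior x j) j = toPath x j ∧
      toPath (removeInterior x j) (j + 1) = toPath x (j + 2) := by
  rw [toPath_removeInterior _ _ _ (by omega), toPath_removeInterior _ _ _ (by omega)]
  simp

/-- Removing a landmark whose two neighbours on the path are not adjacent keeps the length. -/
lemma trailLength_removeInterior {k : ℕ} (x : EulerianTrail G (k + 1) (k + 1)) (j : Fin k)
    (hj : ¬ G.Adj (toPath x.1 j) (toPath x.1 (j + 2))) :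
    trailLength G (removeInterior x.1 j) = ((k + 1 : ℕ) : ℕ∞) := by
  have hstep : ∀ i : Fin k, G.edist (toPath (removeInterior x.1 j) i)
      (toPath (removeInterior x.1 j) (i + 1)) = ((1 + if i = j then 1 else 0 : ℕ) : ℕ∞) := by
    intro i
    split_ifs with hij
    · subst hij
      obtain ⟨e1, e2⟩ := toPath_removeInterior_self x.1 i
      rw [e1, e2]
      have hne : toPath x.1 i ≠ toPath x.1 (i + 2) := fun h => by
        have := x.eq_of_toPath_eq (by omega) (by omega) h
        omega
      have a1 := x.adj i (by omega)
      have a2 := x.adj (i + 1) (by omega)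
      have hle : G.edist (toPath x.1 i) (toPath x.1 (i + 2)) ≤ 2 := by
        simpa using SimpleGraph.edist_le (.cons a1 (.cons a2 .nil))
      obtain ⟨d, hd⟩ := ENat.ne_top_iff_exists.1
        (ne_top_of_le_ne_top (ENat.natCast_ne_top 2) hle)
      rw [← SimpleGraph.edist_eq_one_iff_adj, ← hd] at hj
      rw [← hd] at hle ⊢
      have h0 : (d : ℕ∞) ≠ 0 := fun h => hne (SimpleGraph.edist_eq_zero_iff.1 (hd ▸ h))
      norm_cast at hj hle h0 ⊢
      omega
    · simpa using SimpleGraph.edist_eq_one_iff_adj.2 (adj_removeInterior x hij)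
  rw [trailLength_eq_sum_range, sum_congr rfl fun i _ => hstep i, ← Nat.cast_sum]
  simp [sum_add_distrib]

lemma face_apply {k l : ℕ} (x : EulerianTrail G (k + 1) l) (j : Fin k)
    (r : EulerianTrail G k l) [Decidable (removeInterior x.1 j = r.1)] :
    face x j r = if removeInterior x.1 j = r.1 then 1 else 0 := by
  classical
  rw [face]
  split_ifs with h1 h2 h2
  · exact (Finsupp.single_apply (α := EulerianTrail G k l)).trans (if_pos (Subtype.ext h2))
  · exact (Finsupp.single_apply (α := EulerianTrail G k l)).trans
      (if_neg fun h => h2 (congrArg Subtype.val h))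
  · exact absurd (h2 ▸ r.2.2.1) h1
  · rfl

/-- If a path in the support of a cycle has no chord at position `j + 1`, then its `j`-th face is
nonzero, and it must cancel with the face of another path in the support. Faces at different
positions never cancel, since the position of the nonadjacent step is visible in the face. -/
lemma exists_removeInterior_eq {k : ℕ} {z : EMC G (k + 1) (k + 1)}
    (hz : z ∈ cycles G (k + 1) (k + 1)) {x : EulerianTrail G (k + 1) (k + 1)} (hx : z x ≠ 0)
    (j : Fin k) (hj : ¬ G.Adj (toPath x.1 j) (toPath x.1 (j + 2))) :
    ∃ y : EulerianTrail G (k + 1) (k + 1), z y ≠ 0 ∧ y ≠ x ∧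
      removeInterior y.1 j = removeInterior x.1 j := by
  classical
  by_contra hcon
  push Not at hcon
  have hlen := trailLength_removeInterior x j hj
  set r : EulerianTrail G k (k + 1) := ⟨removeInterior x.1 j, removeInterior_mem x j hlen⟩ with hr
  have hface : ∀ y : EulerianTrail G (k + 1) (k + 1), ∀ i ≠ j, face y i r = 0 := by
    intro y i hij
    rw [face_apply, if_neg]
    intro he
    have := adj_removeInterior y hij.symm
    rw [he, (toPath_removeInterior_self x.1 j).1, (toPath_removeInterior_self x.1 j).2] at this
    exact hj this
  have h0 : differential G k (k + 1) z r = 0 := by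
    have : differential G k (k + 1) z = 0 := hz
    rw [this, Finsupp.zero_apply]
  have hsum : ∀ y : EulerianTrail G (k + 1) (k + 1),
      (∑ i : Fin k, (-1 : ℤ) ^ ((i : ℕ) + 1) • face y i) r =
        (-1 : ℤ) ^ ((j : ℕ) + 1) * face y j r := by
    intro y
    rw [Finsupp.finsetSum_apply, sum_eq_single j]
    · simp
    · intro i _ hij
      simp [hface y i hij]
    · simp
  rw [differential, Finsupp.linearCombination_apply, Finsupp.sum, Finsupp.finsetSum_apply,
    sum_eq_single x] at h0
  · rw [Finsupp.smul_apply, hsum, face_apply, if_pos rfl] at h0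
    simp [hx] at h0
  · intro y hy hyx
    rw [Finsupp.smul_apply, hsum, face_apply, if_neg (hcon y (Finsupp.mem_support_iff.1 hy) hyx)]
    simp
  · intro h
    exact absurd (Finsupp.mem_support_iff.2 hx) h

lemma toPath_eq_of_removeInterior_eq {k : ℕ} {x y : Fin (k + 2) → V} {j : Fin k}
    (h : removeInterior y j = removeInterior x j) {i : ℕ} (hi : i ≠ j + 1) :
    toPath y i = toPath x i := by
  wlog hik : i ≤ k + 1 generalizing i
  · have h1 : ∀ x : Fin (k + 2) → V, toPath x i = toPath x (k + 1) := fun x => by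
      simp [toPath, Nat.min_eq_right (Nat.le_of_not_le hik)]
    rw [h1, h1]
    exact this (by omega) le_rfl
  obtain hlt | hgt := lt_or_gt_of_ne hi
  · have h1 := toPath_removeInterior x j i (by omega)
    have h2 := toPath_removeInterior y j i (by omega)
    rw [if_pos (by omega)] at h1 h2
    rw [← h1, ← h2, h]
  · obtain ⟨i, rfl⟩ : ∃ t, i = t + 1 := ⟨i - 1, by omega⟩
    have h1 := toPath_removeInterior x j i (by omega)
    have h2 := toPath_removeInterior y j i (by omega)
    rw [if_neg (by omega)] at h1 h2
    rw [← h1, ← h2, h]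

/-- The paths in the support of a cycle form a move-closed family. -/
theorem isMoveClosed_support {k : ℕ} (hk : 1 ≤ k) {z : EMC G k k} (hz : z ∈ cycles G k k) :
    IsMoveClosed G k k {X | ∃ x : EulerianTrail G k k, z x ≠ 0 ∧ toPath x.1 = X} := by
  obtain ⟨k, rfl⟩ : ∃ m, k = m + 1 := ⟨k - 1, by omega⟩
  refine ⟨?_, ?_, ?_⟩
  · rintro _ ⟨x, -, rfl⟩ i hi
    exact x.adj i hi
  · rintro _ ⟨x, -, rfl⟩ i hi j hj h
    exact x.eq_of_toPath_eq hi hj h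
  · rintro _ ⟨x, hx, rfl⟩ i hi
    refine or_iff_not_imp_left.2 fun hadj => ?_
    obtain ⟨y, hy, hyx, he⟩ := exists_removeInterior_eq hz hx ⟨i, by omega⟩ hadj
    have hupd : toPath y.1 = Function.update (toPath x.1) (i + 1) (toPath y.1 (i + 1)) := by
      ext t
      by_cases ht : t = i + 1
      · rw [ht, Function.update_self]
      · rw [Function.update_of_ne ht]
        exact toPath_eq_of_removeInterior_eq he ht
    refine ⟨toPath y.1 (i + 1), fun h => hyx (Subtype.ext (toPath_injective ?_)), y, hy, hupd⟩
    rw [hupd, h, Function.update_eq_self]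

instance {n : ℕ} (G : SimpleGraph (Fin n)) (k l : ℕ) : Finite (EulerianTrail G k l) :=
  inferInstanceAs (Finite {x : Fin (k + 1) → Fin n //
    IsTrail G x ∧ trailLength G x = (l : ℕ∞) ∧ Function.Injective x})

/-- The Betti number is at most the number of trails that occur in some cycle. -/
lemma betti_le_ncard {n : ℕ} (G : SimpleGraph (Fin n)) (k : ℕ) :
    betti G k ≤ {x : EulerianTrail G k k | ∃ z ∈ cycles G k k, z x ≠ 0}.ncard := by
  classical
  set A := {x : EulerianTrail G k k | ∃ z ∈ cycles G k k, z x ≠ 0} with hA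
  have hle : cycles G k k ≤ Finsupp.supported ℤ ℤ A := by
    intro z hz
    rw [Finsupp.mem_supported]
    intro x hx
    exact ⟨z, hz, Finsupp.mem_support_iff.1 hx⟩
  calc betti G k ≤ Module.finrank ℤ (cycles G k k) := Submodule.finrank_quotient_le _
    _ ≤ Module.finrank ℤ (Finsupp.supported ℤ ℤ A) := Submodule.finrank_mono hle
    _ = A.ncard := by
      have := Fintype.ofFinite A
      rw [(Finsupp.supportedEquivFinsupp A).finrank_eq, Module.finrank_finsupp_self,
        ← Nat.card_eq_fintype_card, Nat.card_coe_set_eq]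

end Cycles

/-! ### The first moment bound -/

section Expectation

open MeasureTheory

/-- The probability that a binomial random graph contains a given set of `m` pairs is at most
`p ^ m` (it is zero if one of the pairs is degenerate). -/
lemma binomialRandom_real_subset_le {V : Type*} [Countable V] (p : unitInterval)
    (F : Finset (Sym2 V)) :
    (SimpleGraph.binomialRandom V p).real {G | ∀ e ∈ F, e ∈ G.edgeSet} ≤ (p : ℝ) ^ #F := by
  have h : SimpleGraph.binomialRandom V p {G | ∀ e ∈ F, e ∈ G.edgeSet} ≤
      ((unitInterval.toNNReal p : NNReal) : ENNReal) ^ #F := by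
    rw [SimpleGraph.binomialRandom_apply']
    calc _ ≤ ProbabilityTheory.setBernoulli (Sym2.diagSetᶜ) p {s : Set (Sym2 V) | ∀ e ∈ F, e ∈ s} :=
          measure_mono (by rintro _ ⟨G, hG, rfl⟩; exact hG)
      _ = Measure.infinitePi (fun e : Sym2 V => unitInterval.toNNReal p • Measure.dirac
            (e ∈ (Sym2.diagSetᶜ : Set (Sym2 V))) + unitInterval.toNNReal (unitInterval.symm p) •
              Measure.dirac False) (Set.pi F fun _ => {True}) := by
          rw [ProbabilityTheory.setBernoulli_apply']
          congr 1
          ext f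
          simp
      _ ≤ _ := by
          rw [Measure.infinitePi_pi _ (fun _ _ => MeasurableSet.singleton _), ← prod_const]
          refine prod_le_prod' fun e _ => ?_
          by_cases he : e ∈ (Sym2.diagSetᶜ : Set (Sym2 V)) <;> simp [he, Set.indicator]
  have h2 := ENNReal.toReal_mono (by simp) h
  simpa [Measure.real] using h2

lemma measurableSet_subset_edgeSet {V : Type*} (F : Finset (Sym2 V)) :
    MeasurableSet {G : SimpleGraph V | ∀ e ∈ F, e ∈ G.edgeSet} := by
  have : {G : SimpleGraph V | ∀ e ∈ F, e ∈ G.edgeSet} =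
      ⋂ e ∈ F, SimpleGraph.edgeSet ⁻¹' {s | e ∈ s} := by
    ext G
    simp
  rw [this]
  exact F.measurableSet_biInter fun e _ =>
    SimpleGraph.measurable_edgeSet (measurableSet_setOfPred.2 (measurable_set_mem e))

/-- The least number of edges that a `v`-set with at least `(2k - 1) / (k + 1)` edges per vertex
can have. -/
noncomputable def minEdges (k v : ℕ) : ℕ :=
  ⌈((2 * k - 1) * v / (k + 1) : ℝ)⌉₊

lemma minEdges_le {V : Type*} {G : SimpleGraph V} {k : ℕ} {U : Finset V}
    (h : (k + 1) * deficit G U ≤ 3 * #U) : minEdges k #U ≤ #(edgesIn G U) := by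
  rw [minEdges, Nat.ceil_le, div_le_iff₀ (by positivity)]
  have h1 : ((2 * k - 1) * #U : ℤ) ≤ #(edgesIn G U) * (k + 1) := by
    rw [deficit] at h
    linarith
  exact_mod_cast h1

/-- Pairs of a vertex set `U` with between `k + 1` and `(k + 1) * (k + 2)` elements, sorted by its
size, and a set of `minEdges k #U` pairs of elements of `U`. -/
noncomputable def denseSpots (n k : ℕ) :
    Finset (Σ _ : ℕ, Σ _ : Finset (Fin n), Finset (Sym2 (Fin n))) :=
  (Icc (k + 1) ((k + 1) * (k + 2))).sigma fun v =>
    (powersetCard v univ).sigma fun U => powersetCard (minEdges k v) U.sym2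

open Classical in
/-- Every trail that occurs in a cycle lies in a dense set of bounded size. The sum runs over all
places where such a set may occur, independently of `G`, so its expectation can be taken termwise;
each set of `v` vertices carries at most `v ^ (k + 1)` trails. -/
lemma betti_le_sum_denseSpots {n : ℕ} (G : SimpleGraph (Fin n)) {k : ℕ} (hk : 1 ≤ k) :
    betti G k ≤ ∑ s ∈ denseSpots n k,
      if ∀ e ∈ s.2.2, e ∈ G.edgeSet then s.1 ^ (k + 1) else 0 := by
  refine (betti_le_ncard G k).trans ?_
  set A := {x : EulerianTrail G k k | ∃ z ∈ cycles G k k, z x ≠ 0} with hA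
  set B : Finset (Fin (k + 1) → Fin n) :=
    ((denseSpots n k).filter fun s => ∀ e ∈ s.2.2, e ∈ G.edgeSet).biUnion
      fun s => Fintype.piFinset fun _ => s.2.1 with hB
  have hAB : A.ncard ≤ #B := by
    rw [← Set.ncard_coe_finset]
    refine Set.ncard_le_ncard_of_injOn (fun x => x.1) ?_ (fun x _ y _ h => Subtype.ext h)
    rintro x ⟨z, hz, hzx⟩
    obtain ⟨U, hxU, hUM, hU⟩ :=
      (isMoveClosed_support hk hz).exists_dense_superset hk ⟨x, hzx, rfl⟩
    have hx : ∀ i : Fin (k + 1), x.1 i ∈ U := fun i => by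
      rw [← toPath_apply x.1 i]
      exact hxU i (by omega)
    have hkU : k + 1 ≤ #U := by
      rw [← Fintype.card_fin (k + 1), ← card_univ]
      exact card_le_card_of_injOn x.1 (fun i _ => hx i) x.2.2.2.injOn
    obtain ⟨F, hF, hFcard⟩ := exists_subset_card_eq (minEdges_le hU)
    rw [mem_coe, hB, mem_biUnion]
    refine ⟨⟨#U, U, F⟩, mem_filter.2 ⟨?_, fun e he => ?_⟩, Fintype.mem_piFinset.2 hx⟩
    · simp only [denseSpots, mem_sigma, mem_Icc, mem_powersetCard, subset_univ, and_self, true_and]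
      exact ⟨⟨hkU, hUM⟩, hF.trans (filter_subset _ _), hFcard⟩
    · exact (mem_filter.1 (hF he)).2
  refine hAB.trans (card_biUnion_le.trans ?_)
  rw [← sum_filter]
  refine sum_le_sum fun s hs => ?_
  have hs := (mem_filter.1 hs).1
  simp only [denseSpots, mem_sigma, mem_powersetCard] at hs
  rw [Fintype.card_piFinset_const, hs.2.1.2]

/-- The first moment bound: the number of `v`-sets of vertices is at most `n ^ v`, and the number
of choices of edges inside one of them depends on `v` only. -/
lemma expectedBetti_le (n : ℕ) {k : ℕ} (hk : 1 ≤ k) (p : unitInterval) :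
    expectedBetti k n p ≤ ∑ v ∈ Icc (k + 1) ((k + 1) * (k + 2)),
      (((v + 1).choose 2).choose (minEdges k v) * v ^ (k + 1) : ℝ) *
        ((n : ℝ) ^ v * (p : ℝ) ^ minEdges k v) := by
  classical
  have hint : ∀ s : Σ _ : ℕ, Σ _ : Finset (Fin n), Finset (Sym2 (Fin n)),
      Integrable (fun G : SimpleGraph (Fin n) =>
        if ∀ e ∈ s.2.2, e ∈ G.edgeSet then (s.1 : ℝ) ^ (k + 1) else 0)
        (SimpleGraph.binomialRandom (Fin n) p) := by
    intro s
    have h := (integrable_const (μ := SimpleGraph.binomialRandom (Fin n) p)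
      ((s.1 : ℝ) ^ (k + 1))).indicator (measurableSet_subset_edgeSet s.2.2)
    exact h.congr (.of_forall fun G => by simp only [Set.indicator, Set.mem_ofPred_eq])
  calc expectedBetti k n p
      ≤ ∫ G, ∑ s ∈ denseSpots n k,
          (if ∀ e ∈ s.2.2, e ∈ G.edgeSet then (s.1 : ℝ) ^ (k + 1) else 0)
          ∂SimpleGraph.binomialRandom (Fin n) p := by
        refine integral_mono_of_nonneg (.of_forall fun G => by positivity)
          (integrable_finsetSum _ fun s _ => hint s) (.of_forall fun G => ?_)
        have h := betti_le_sum_denseSpots G hk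
        have h' : (betti G k : ℝ) ≤ ((∑ s ∈ denseSpots n k,
          if ∀ e ∈ s.2.2, e ∈ G.edgeSet then s.1 ^ (k + 1) else 0 : ℕ) : ℝ) := by exact_mod_cast h
        push_cast at h'
        exact h'
    _ ≤ ∑ s ∈ denseSpots n k, (s.1 : ℝ) ^ (k + 1) * (p : ℝ) ^ minEdges k s.1 := by
        rw [integral_finsetSum _ fun s _ => hint s]
        refine sum_le_sum fun s hs => ?_
        simp only [denseSpots, mem_sigma, mem_powersetCard] at hs
        have h1 := binomialRandom_real_subset_le p s.2.2
        rw [hs.2.2.2] at h1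
        have h2 := integral_indicator_const (μ := SimpleGraph.binomialRandom (Fin n) p)
          ((s.1 : ℝ) ^ (k + 1)) (measurableSet_subset_edgeSet s.2.2)
        simp only [Set.indicator, Set.mem_ofPred_eq, smul_eq_mul] at h2
        rw [h2, mul_comm]
        exact mul_le_mul_of_nonneg_left h1 (by positivity)
    _ ≤ _ := by
        rw [denseSpots, sum_sigma]
        refine sum_le_sum fun v _ => ?_
        have hU : ∀ U ∈ powersetCard v (univ : Finset (Fin n)),
            #(powersetCard (minEdges k v) U.sym2) =
              ((v + 1).choose 2).choose (minEdges k v) := by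
          intro U hU
          rw [card_powersetCard, card_sym2, (mem_powersetCard.1 hU).2]
        dsimp only
        rw [sum_const, card_sigma, sum_congr rfl hU, sum_const, card_powersetCard, card_univ,
          Fintype.card_fin]
        have hn : (n.choose v : ℝ) ≤ (n : ℝ) ^ v := by exact_mod_cast Nat.choose_le_pow n v
        have hp := p.2.1
        rw [nsmul_eq_mul, smul_eq_mul, Nat.cast_mul]
        calc _ = (((v + 1).choose 2).choose (minEdges k v) * v ^ (k + 1) : ℝ) *
              ((n.choose v : ℝ) * (p : ℝ) ^ minEdges k v) := by ring
          _ ≤ _ := by gcongr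

end Expectation

end EulerianMagnitude

theorem mainTheorem6 (k : ℕ) (hk : 1 ≤ k) (q : ℝ)
    (hq : ((k : ℝ) + 1) / (2 * (k : ℝ) - 1) < q)
    (p : ℕ → unitInterval) (hp : ∀ n : ℕ, 1 ≤ n → (p n : ℝ) = (n : ℝ) ^ (-q)) :
    Filter.Tendsto (fun n : ℕ => EulerianMagnitude.expectedBetti k n (p n))
      Filter.atTop (nhds 0) := by
  have hk' : (1 : ℝ) ≤ k := by exact_mod_cast hk
  have hq' : (k : ℝ) + 1 < q * (2 * k - 1) := (div_lt_iff₀ (by linarith)).1 hq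
  have hq0 : 0 < q := lt_trans (div_pos (by linarith) (by linarith)) hq
  refine squeeze_zero (fun n => MeasureTheory.integral_nonneg fun G => by positivity)
    (fun n => EulerianMagnitude.expectedBetti_le n hk (p n)) ?_
  rw [← Finset.sum_const_zero (s := Finset.Icc (k + 1) ((k + 1) * (k + 2)))]
  refine tendsto_finsetSum _ fun v hv => ?_
  rw [← mul_zero ((((v + 1).choose 2).choose (EulerianMagnitude.minEdges k v) * v ^ (k + 1) : ℝ))]
  refine Filter.Tendsto.const_mul _ ?_
  set m := EulerianMagnitude.minEdges k v with hm
  have hexp : 0 < q * m - v := by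
    have hv0 : (0 : ℝ) < v := by
      have := (Finset.mem_Icc.1 hv).1
      exact_mod_cast (by omega : 0 < v)
    have h1 : ((2 * k - 1) * v / (k + 1) : ℝ) ≤ m := Nat.le_ceil _
    rw [div_le_iff₀ (by positivity)] at h1
    have h2 : q * ((2 * k - 1) * v) ≤ q * (m * (k + 1)) := mul_le_mul_of_nonneg_left h1 hq0.le
    have h3 : ((k : ℝ) + 1) * v < q * (2 * k - 1) * v := mul_lt_mul_of_pos_right hq' hv0
    have h4 : 0 < (q * m - v) * ((k : ℝ) + 1) := by linarith
    exact pos_of_mul_pos_left h4 (by positivity)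
  refine ((tendsto_rpow_neg_atTop hexp).comp tendsto_natCast_atTop_atTop).congr' ?_
  filter_upwards [Filter.eventually_ge_atTop 1] with n hn
  have hn0 : (0 : ℝ) < n := by exact_mod_cast hn
  rw [Function.comp_apply, hp n hn, ← Real.rpow_natCast (n : ℝ) v, ← Real.rpow_natCast _ m,
    ← Real.rpow_mul hn0.le, ← Real.rpow_add hn0]
  congr 1
  ring
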